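/- Let $(\mathbb Z/2\mathbb Z)^4=\{(a_1,\dots,a_5)\in(\mathbb Z/2\mathbb Z)^5 : a_1+\dots+a_5=0\}$, and let $S_5$ act on it by permuting the coordinates. Let $\mathfrak P\subset\mathbb Q^5$ be the free abelian group of rank $5$ generated by the standard basis vectors $[e_1],\dots,[e_5]$ together with $\tfrac12([e_1]+\dots+[e_5])$. The group $(\mathbb Z/2\mathbb Z)^4\rtimes S_5$ acts on $\mathfrak P$ in the natural way: $S_5$ permutes the indices, and $(a_1,\dots,a_5)$ sends $[e_i]$ to $(-1)^{a_i}[e_i]$. For a subgroup $G\subseteq(\mathbb Z/2\mathbb Z)^4\rtimes S_5$, let $H^1(G,\mathfrak P)_2=\{x\in H^1(G,\mathfrak P) : 2x=0\}$, and call $x\in H^1(G,\mathfrak P)$ a proper $4$-torsion class if $4x=0$ but $2x\neq0$. Theorem. Let $G\subseteq(\mathbb Z/2\mathbb Z)^4\rtimes S_5$ be a subgroup and let $G'\subseteq G$ be another. Suppose that both $H^1(G,\mathfrak P)$ and $H^1(G',\mathfrak P)$ contain proper $4$-torsion classes. Then the homomorphism $$\overline{\mathrm{res}}{}^G_{G'}\colon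 H^1(G,\mathfrak P)/H^1(G,\mathfrak P)_2\longrightarrow H^1(G',\mathfrak P)/H^1(G',\mathfrak P)_2$$ induced by the restriction map $H^1(G,\mathfrak P)\to H^1(G',\mathfrak P)$ is an isomorphism, and both groups are of order $2$. -/

import Mathlib

namespace OpenDelPezzo4

/-- The group `(ℤ/2ℤ)⁴`, realised as the kernel of the sum map on `(ℤ/2ℤ)⁵`.
The group `ℤ/2ℤ` is written multiplicatively as `ℤˣ = {1, -1}`. -/
def signs : Subgroup (Fin 5 → ℤˣ) where
  carrier := {a | ∏ i, a i = 1}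
  one_mem' := by simp
  mul_mem' := by
    intro a b ha hb
    simp only [Set.mem_ofPred_eq, Pi.mul_apply, Finset.prod_mul_distrib] at *
    rw [ha, hb, one_mul]
  inv_mem' := by
    intro a ha
    simp only [Set.mem_ofPred_eq, Pi.inv_apply, Finset.prod_inv_distrib] at *
    rw [ha, inv_one]

/-- The permutation `σ` of the indices, acting on sign vectors by `(σ a) (σ i) = a i`. -/
def permAut (σ : Equiv.Perm (Fin 5)) : MulAut signs where
  toFun a := ⟨fun i => a.1 (σ⁻¹ i), by
    have h : ∏ i, a.1 i = 1 := a.2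
    change ∏ i, a.1 (σ⁻¹ i) = 1
    rw [Equiv.prod_comp σ⁻¹ a.1, h]⟩
  invFun a := ⟨fun i => a.1 (σ i), by
    have h : ∏ i, a.1 i = 1 := a.2
    change ∏ i, a.1 (σ i) = 1
    rw [Equiv.prod_comp σ a.1, h]⟩
  left_inv a := by ext i; simp
  right_inv a := by ext i; simp
  map_mul' a b := rfl

/-- The action of `S₅` on `(ℤ/2ℤ)⁴` by permuting the indices. -/
def permHom : Equiv.Perm (Fin 5) →* MulAut signs where
  toFun := permAut
  map_one' := rfl
  map_mul' _ _ := rfl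

/-- The group `(ℤ/2ℤ)⁴ ⋊ S₅`, of order `1920`. -/
abbrev W : Type := signs ⋊[permHom] Equiv.Perm (Fin 5)

/-- The natural action of `(ℤ/2ℤ)⁴ ⋊ S₅` on `ℚ⁵`: the element `(a, σ)` sends the
basis vector `[e_i]` to `a_{σ i} [e_{σ i}]`. -/
def ratRep : Representation ℤ W (Fin 5 → ℚ) where
  toFun w :=
    { toFun := fun v i => ((w.left.1 i : ℤ) : ℚ) * v (w.right⁻¹ i)
      map_add' := fun u v => by ext i; simp [mul_add]
      map_smul' := fun c v => by ext i; simp [mul_left_comm] }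
  map_one' := by ext v i; simp
  map_mul' u w := by
    refine LinearMap.ext fun v => funext fun i => ?_
    change (((u.left.1 i * w.left.1 (u.right⁻¹ i) : ℤˣ) : ℤ) : ℚ) * v ((u.right * w.right)⁻¹ i) =
      ((u.left.1 i : ℤ) : ℚ) * (((w.left.1 (u.right⁻¹ i) : ℤ) : ℚ) * v (w.right⁻¹ (u.right⁻¹ i)))
    rw [mul_inv_rev, Equiv.Perm.mul_apply]
    push_cast
    ring

/-- The lattice `𝔓` in `ℚ⁵`, generated by the standard basis vectors `[e_1], …, [e_5]`
together with `½ ([e_1] + ⋯ + [e_5])`. -/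
def lattice : Submodule ℤ (Fin 5 → ℚ) :=
  Submodule.span ℤ (Set.range (fun i : Fin 5 => (Pi.single i 1 : Fin 5 → ℚ)) ∪
    {(fun _ => 1 / 2 : Fin 5 → ℚ)})

theorem single_mem_lattice (i : Fin 5) : (Pi.single i 1 : Fin 5 → ℚ) ∈ lattice :=
  Submodule.subset_span (Or.inl ⟨i, rfl⟩)

theorem half_mem_lattice : (fun _ => 1 / 2 : Fin 5 → ℚ) ∈ lattice :=
  Submodule.subset_span (Or.inr rfl)

/-- The lattice `𝔓` is stable under the group. -/
theorem ratRep_mem_lattice (w : W) (v : Fin 5 → ℚ) (hv : v ∈ lattice) :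
    ratRep w v ∈ lattice := by
  refine (Submodule.span_le (p := lattice.comap (ratRep w))).2 ?_ hv
  rintro _ (⟨j, rfl⟩ | rfl)
  · have h : ratRep w (Pi.single j 1) =
        ((w.left.1 (w.right j) : ℤˣ) : ℤ) • (Pi.single (w.right j) 1 : Fin 5 → ℚ) := by
      ext i
      change ((w.left.1 i : ℤ) : ℚ) * (Pi.single j 1 : Fin 5 → ℚ) (w.right⁻¹ i) = _
      by_cases hi : i = w.right j
      · subst hi; simp
      · have hi' : w.right⁻¹ i ≠ j := fun h => hi (by simp [← h])
        rw [Pi.single_eq_of_ne hi', mul_zero, Pi.smul_apply, Pi.single_eq_of_ne hi, smul_zero]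
    change ratRep w (Pi.single j 1) ∈ lattice
    rw [h]
    exact lattice.smul_mem _ (single_mem_lattice _)
  · have h : ratRep w (fun _ => 1 / 2) = (fun _ => 1 / 2 : Fin 5 → ℚ) -
        ∑ j, (if w.left.1 j = 1 then (0 : ℤ) else 1) • (Pi.single j 1 : Fin 5 → ℚ) := by
      ext i
      change ((w.left.1 i : ℤ) : ℚ) * (1 / 2) = _
      rw [Pi.sub_apply, Finset.sum_apply, Finset.sum_eq_single i]
      · rcases Int.units_eq_one_or (w.left.1 i) with hi | hi
        · simp [hi]
        · simp [hi]
          norm_num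
      · intro j _ hj
        rw [Pi.smul_apply, Pi.single_eq_of_ne hj.symm, smul_zero]
      · simp
    change ratRep w (fun _ => 1 / 2) ∈ lattice
    rw [h]
    exact lattice.sub_mem half_mem_lattice
      (lattice.sum_mem fun j _ => lattice.smul_mem _ (single_mem_lattice j))

/-- The `(ℤ/2ℤ)⁴ ⋊ S₅`-module `𝔓`. -/
def latticeRep : Representation ℤ W lattice where
  toFun w := (ratRep w).restrict (ratRep_mem_lattice w)
  map_one' := by ext v : 2; simp [LinearMap.restrict_apply]
  map_mul' u w := by ext v : 2; simp [LinearMap.restrict_apply]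

/-- The module `𝔓`, regarded as a module over the subgroup `G`. -/
abbrev moduleOver (G : Subgroup W) : Rep ℤ G :=
  Rep.of (latticeRep.comp G.subtype)

/-- The group cohomology `H¹(G, 𝔓)`. -/
noncomputable abbrev H1 (G : Subgroup W) : Type :=
  groupCohomology (moduleOver G) 1

/-- The restriction homomorphism `H¹(G, 𝔓) → H¹(G', 𝔓)`, for `G' ⊆ G`, induced by the
inclusion `G' → G` and the identity on `𝔓`. -/
noncomputable def res {G G' : Subgroup W} (h : G' ≤ G) : H1 G →+ H1 G' :=
  (groupCohomology.map (A := moduleOver G) (B := moduleOver G') (Subgroup.inclusion h)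
    (CategoryTheory.CategoryStruct.id (moduleOver G')) 1).hom.toAddMonoidHom

/-- The subgroup `H¹(G, 𝔓)₂` of all elements annihilated by `2`. -/
noncomputable abbrev H1Two (G : Subgroup W) : AddSubgroup (H1 G) :=
  AddSubgroup.torsionBy (H1 G) 2

/-- Restriction maps `H¹(G, 𝔓)₂` to `H¹(G', 𝔓)₂`. -/
theorem H1Two_le_comap_res {G G' : Subgroup W} (h : G' ≤ G) :
    H1Two G ≤ (H1Two G').comap (res h) := by
  intro x hx
  change (2 : ℤ) • res h x = 0
  rw [← map_zsmul, show (2 : ℤ) • x = 0 from hx, map_zero]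

/-- The homomorphism `H¹(G, 𝔓)/H¹(G, 𝔓)₂ → H¹(G', 𝔓)/H¹(G', 𝔓)₂` induced by restriction. -/
noncomputable def resBar {G G' : Subgroup W} (h : G' ≤ G) :
    (H1 G ⧸ H1Two G) →+ (H1 G' ⧸ H1Two G') :=
  QuotientAddGroup.map (H1Two G) (H1Two G') (res h) (H1Two_le_comap_res h)

/-- A proper `4`-torsion class is one annihilated by `4`, but not by `2`. -/
def IsProperFourTorsion {G : Subgroup W} (x : H1 G) : Prop :=
  4 • x = 0 ∧ 2 • x ≠ 0

end OpenDelPezzo4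

/-!
As `H¹(G, ℚ⁵) = 0`, every class in `H¹(G, 𝔓)` is that of a cocycle `g ↦ g v - v` for some
`v ∈ ℚ⁵`, and rounding `v` in a way compatible with signed permutations achieves `v ∈ ¼ℤ⁵`
(`exists_rounding`, `exists_classOf_eq`). Each displacement `g v - v` lies in `ℤ⁵` or in the coset
`(½, …, ½) + ℤ⁵`, which defines the character `ψ : G → 𝔓/ℤ⁵ = ℤ/2` of the class. If `ψ` is trivial,
the class comes from `H¹(G, ℤ⁵)`, which is annihilated by `2` (`two_nsmul_classOf_eq_zero`).

Two invariants of a signed permutation `g` control the half-integral displacements of `v = a/4`.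
* The length: `|g v|² = |v|²` gives that `∑ a i` is odd (`odd_sum_of_half`).
* The product of the signs, which is `1`: not all the `a i` are odd (`exists_even_of_half`).

Together they show that `2 x ≠ 0` as soon as the character of `x` is nontrivial on the group under
consideration (`two_nsmul_classOf_ne_zero`). The first alone shows, by additivity of `a ↦ ∑ a i`,
that the characters of two classes `x` on `G` and `x'` on `G'`, both outside the `2`-torsion, agree
where that of `x'` is nontrivial (`notMem_integral_of_notMem_integral`). For `G' = G` this means
that all classes outside the `2`-torsion have the same character, so that they differ by
`2`-torsion and the quotient has order `2`. For `G' ≤ G` it means that the character of `x` remains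
nontrivial on `G'`, so that `res x` is outside the `2`-torsion.
-/

namespace OpenDelPezzo4

/-! ### The lattice and its integral sublattice -/

theorem ratRep_apply (w : W) (v : Fin 5 → ℚ) (i : Fin 5) :
    ratRep w v i = ((w.left.1 i : ℤ) : ℚ) * v (w.right⁻¹ i) := rfl

/-- The sublattice `ℤ⁵` of `ℚ⁵`. It has index `2` in `𝔓`. -/
def integral : AddSubgroup (Fin 5 → ℚ) := ((Int.castAddHom ℚ).compLeft (Fin 5)).range

theorem mem_integral {v : Fin 5 → ℚ} : v ∈ integral ↔ ∃ n : Fin 5 → ℤ, ∀ i, v i = n i := by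
  constructor
  · rintro ⟨n, rfl⟩
    exact ⟨n, fun i => rfl⟩
  · rintro ⟨n, hn⟩
    exact ⟨n, funext fun i => (hn i).symm⟩

theorem integral_le_lattice {v : Fin 5 → ℚ} (hv : v ∈ integral) : v ∈ lattice := by
  obtain ⟨n, hn⟩ := mem_integral.1 hv
  have : v = ∑ i, n i • (Pi.single i 1 : Fin 5 → ℚ) := by
    ext j
    simp [hn, Finset.sum_apply, Pi.single_apply]
  rw [this]
  exact lattice.sum_mem fun i _ => lattice.smul_mem _ (single_mem_lattice i)

/-- The parity of `m` tells the two cosets of `ℤ⁵` in `𝔓` apart. -/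
theorem exists_of_mem_lattice {v : Fin 5 → ℚ} (hv : v ∈ lattice) :
    ∃ (n : Fin 5 → ℤ) (m : ℤ), ∀ i, v i = n i + m / 2 := by
  induction hv using Submodule.span_induction with
  | mem x hx =>
    rcases hx with ⟨j, rfl⟩ | rfl
    · exact ⟨Pi.single j 1, 0, fun i => by by_cases h : i = j <;> simp [h]⟩
    · exact ⟨0, 1, fun i => by simp⟩
  | zero => exact ⟨0, 0, fun i => by simp⟩
  | add x y _ _ hx hy =>
    obtain ⟨n, m, h⟩ := hx
    obtain ⟨n', m', h'⟩ := hy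
    exact ⟨n + n', m + m', fun i => by simp [h, h']; ring⟩
  | smul c x _ hx =>
    obtain ⟨n, m, h⟩ := hx
    exact ⟨c • n, c * m, fun i => by simp [h]; ring⟩

/-- An element of `𝔓` outside `ℤ⁵` has all its coordinates in `½ + ℤ`. -/
theorem exists_half_of_mem_lattice {v : Fin 5 → ℚ} (hv : v ∈ lattice) (hv' : v ∉ integral) :
    ∃ n : Fin 5 → ℤ, ∀ i, v i = n i + 1 / 2 := by
  obtain ⟨n, m, h⟩ := exists_of_mem_lattice hv
  rcases Int.even_or_odd' m with ⟨k, rfl | rfl⟩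
  · exact absurd (mem_integral.2 ⟨fun i => n i + k, fun i => by rw [h]; push_cast; ring⟩) hv'
  · exact ⟨fun i => n i + k, fun i => by rw [h]; push_cast; ring⟩

theorem sub_mem_integral_of_notMem {u v : Fin 5 → ℚ} (hu : u ∈ lattice) (hv : v ∈ lattice)
    (hu' : u ∉ integral) (hv' : v ∉ integral) : u - v ∈ integral := by
  obtain ⟨m, hm⟩ := exists_half_of_mem_lattice hu hu'
  obtain ⟨n, hn⟩ := exists_half_of_mem_lattice hv hv'
  exact mem_integral.2 ⟨m - n, fun i => by simp [hm, hn]⟩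

/-! ### Classes in `H¹(G, 𝔓)` as vectors of `ℚ⁵` -/

/-- The vectors of `ℚ⁵` whose classes modulo `𝔓` are fixed by `G`, or equivalently those whose
coboundary `g ↦ g v - v` takes values in `𝔓`. -/
def potentials (G : Subgroup W) : AddSubgroup (Fin 5 → ℚ) where
  carrier := {v | ∀ g ∈ G, ratRep g v - v ∈ lattice}
  zero_mem' := fun g _ => by simp
  add_mem' := by
    intro u v hu hv g hg
    rw [map_add, add_sub_add_comm]
    exact lattice.add_mem (hu g hg) (hv g hg)
  neg_mem' := by
    intro v hv g hg
    rw [map_neg, ← neg_sub', neg_sub', ← neg_sub']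
    exact lattice.neg_mem (hv g hg)

theorem potentials_anti {G G' : Subgroup W} (h : G' ≤ G) : potentials G ≤ potentials G' :=
  fun _ hv g hg => hv g (h hg)

/-- The `𝔓`-valued cocycle `g ↦ g v - v` attached to `v`, which is a coboundary in `ℚ⁵`. -/
def toCocycle (G : Subgroup W) : potentials G →+ groupCohomology.cocycles₁ (moduleOver G) where
  toFun v := ⟨fun g => (⟨ratRep g.1 v.1 - v.1, v.2 g.1 g.2⟩ : lattice), by
    rw [groupCohomology.mem_cocycles₁_iff]
    intro g h
    apply Subtype.ext
    change ratRep (g.1 * h.1) v.1 - v.1 = ratRep g.1 (ratRep h.1 v.1 - v.1) + (ratRep g.1 v.1 - v.1)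
    rw [map_mul, map_sub, Module.End.mul_apply]
    abel⟩
  map_zero' := by
    refine groupCohomology.cocycles₁_ext fun g => Subtype.ext ?_
    change ratRep g.1 0 - 0 = 0
    simp
  map_add' u v := by
    refine groupCohomology.cocycles₁_ext fun g => Subtype.ext ?_
    change ratRep g.1 (u.1 + v.1) - (u.1 + v.1) = (ratRep g.1 u.1 - u.1) + (ratRep g.1 v.1 - v.1)
    rw [map_add, add_sub_add_comm]

/-- The class of the cocycle `g ↦ g v - v`, that is, the connecting homomorphism
`(ℚ⁵/𝔓)^G → H¹(G, 𝔓)`, precomposed with the reduction modulo `𝔓`. -/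
noncomputable def classOf (G : Subgroup W) : potentials G →+ H1 G :=
  (groupCohomology.H1π (moduleOver G)).hom.toAddMonoidHom.comp (toCocycle G)

theorem classOf_apply (G : Subgroup W) (v : potentials G) :
    classOf G v = groupCohomology.H1π (moduleOver G) (toCocycle G v) := rfl

instance : Finite W := Finite.of_equiv _ SemidirectProduct.equivProd.symm

/-- As `H¹(G, ℚ⁵) = 0`, every class comes from a vector of `ℚ⁵`: averaging a cocycle over `G`
exhibits it as a rational coboundary. -/
theorem classOf_surjective (G : Subgroup W) : Function.Surjective (classOf G) := by
  intro x
  induction x using groupCohomology.H1_induction_on with | h f =>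
  have := Fintype.ofFinite G
  let c : G → Fin 5 → ℚ := fun g => ((f g : lattice) : Fin 5 → ℚ)
  have hc : ∀ g h : G, c (g * h) = ratRep g.1 (c h) + c g := fun g h =>
    congrArg Subtype.val ((groupCohomology.mem_cocycles₁_iff f.1).1 f.2 g h)
  let N : ℚ := Fintype.card G
  have hN : N ≠ 0 := by simp [N]
  let V : Fin 5 → ℚ := ∑ h, c h
  have hV : ∀ g : G, ratRep g.1 V = V - N • c g := by
    intro g
    have h1 : ∑ h, c (g * h) = V := Fintype.sum_equiv (Equiv.mulLeft g) _ _ fun _ => rfl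
    simp only [hc, Finset.sum_add_distrib, ← map_sum, Finset.sum_const, Finset.card_univ,
      ← Nat.cast_smul_eq_nsmul ℚ] at h1
    exact eq_sub_of_add_eq h1
  have hlin : ∀ (g : W) (q : ℚ) (v : Fin 5 → ℚ), ratRep g (q • v) = q • ratRep g v := by
    intro g q v
    ext i
    simp only [ratRep_apply, Pi.smul_apply, smul_eq_mul]
    ring
  have hv : ∀ g : G, ratRep g.1 ((-N⁻¹) • V) - (-N⁻¹) • V = c g := by
    intro g
    rw [hlin, hV, ← smul_sub, sub_sub_cancel_left, smul_neg, neg_smul, neg_neg, smul_smul,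
      inv_mul_cancel₀ hN, one_smul]
  refine ⟨⟨(-N⁻¹) • V, fun g hg => ?_⟩, ?_⟩
  · rw [hv ⟨g, hg⟩]
    exact (f ⟨g, hg⟩ : lattice).2
  · rw [classOf_apply]
    congr 1
    exact groupCohomology.cocycles₁_ext fun g => Subtype.ext (hv g)

theorem classOf_eq_zero_iff {G : Subgroup W} (v : potentials G) :
    classOf G v = 0 ↔ ∃ p ∈ lattice, ∀ g ∈ G, ratRep g (v.1 - p) = v.1 - p := by
  rw [classOf_apply, groupCohomology.H1π_eq_zero_iff]
  constructor
  · rintro ⟨p, hp⟩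
    refine ⟨(p : lattice).1, (p : lattice).2, fun g hg => ?_⟩
    have h : ratRep g (p : lattice).1 - (p : lattice).1 = ratRep g v.1 - v.1 :=
      congrArg Subtype.val (congrFun hp ⟨g, hg⟩)
    rw [map_sub, sub_eq_sub_iff_sub_eq_sub, h]
  · rintro ⟨p, hp, h⟩
    refine ⟨(⟨p, hp⟩ : lattice), funext fun g => Subtype.ext ?_⟩
    change ratRep g.1 p - p = ratRep g.1 v.1 - v.1
    have := h g.1 g.2
    rwa [map_sub, sub_eq_sub_iff_sub_eq_sub, eq_comm] at this

theorem res_classOf {G G' : Subgroup W} (h : G' ≤ G) (v : potentials G) :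
    res h (classOf G v) = classOf G' ⟨v.1, potentials_anti h v.2⟩ := by
  refine (groupCohomology.H1π_comp_map_apply (A := moduleOver G) (B := moduleOver G')
    (Subgroup.inclusion h) (CategoryTheory.CategoryStruct.id (moduleOver G'))
    (toCocycle G v)).trans ?_
  rw [classOf_apply]
  congr 1

/-! ### Rounding -/

/-- The map `x ↦ (⌊x⌋ + ⌈x⌉) / 2` into `½ℤ` is odd and commutes with integral translations, so
its coordinatewise application commutes with signed permutations. Subtracting it from a vector
that is invariant modulo `ℤ⁵` thus leaves an invariant vector. -/
theorem exists_rounding {G : Subgroup W} {v : Fin 5 → ℚ}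
    (hv : ∀ g ∈ G, ratRep g v - v ∈ integral) :
    ∃ r : Fin 5 → ℚ, 2 • r ∈ integral ∧ ∀ g ∈ G, ratRep g (v - r) = v - r := by
  refine ⟨fun i => (⌊v i⌋ + ⌈v i⌉) / 2, mem_integral.2 ⟨fun i => ⌊v i⌋ + ⌈v i⌉, fun i => ?_⟩, ?_⟩
  · simp
    ring
  · intro g hg
    obtain ⟨n, hn⟩ := mem_integral.1 (hv g hg)
    ext i
    have hi := hn i
    rw [Pi.sub_apply, ratRep_apply] at hi
    rw [ratRep_apply, Pi.sub_apply, Pi.sub_apply]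
    rcases Int.units_eq_one_or (g.left.1 i) with hs | hs
    · have h1 : v (g.right⁻¹ i) = v i + n i := by
        rw [hs] at hi
        push_cast at hi
        linarith
      rw [hs, h1, Int.floor_add_intCast, Int.ceil_add_intCast]
      push_cast
      ring
    · have h1 : v (g.right⁻¹ i) = -(v i + n i) := by
        rw [hs] at hi
        push_cast at hi
        linarith
      rw [hs, h1, Int.floor_neg, Int.ceil_neg, Int.floor_add_intCast, Int.ceil_add_intCast]
      push_cast
      ring

/-- If `g v - v` is always integral, the class comes from `H¹(G, ℤ⁵)`, which `2` annihilates. -/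
theorem two_nsmul_classOf_eq_zero {G : Subgroup W} (v : potentials G)
    (hv : ∀ g ∈ G, ratRep g v.1 - v.1 ∈ integral) : 2 • classOf G v = 0 := by
  obtain ⟨r, hr, h⟩ := exists_rounding hv
  rw [← map_nsmul, classOf_eq_zero_iff]
  refine ⟨2 • r, integral_le_lattice hr, fun g hg => ?_⟩
  change ratRep g (2 • v.1 - 2 • r) = 2 • v.1 - 2 • r
  rw [← nsmul_sub, map_nsmul, h g hg]

/-- Every class is represented by a vector with coordinates in `¼ℤ`. -/
theorem exists_classOf_eq {G : Subgroup W} (x : H1 G) :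
    ∃ (v : potentials G) (a : Fin 5 → ℤ), classOf G v = x ∧ ∀ i, v.1 i = a i / 4 := by
  obtain ⟨v, rfl⟩ := classOf_surjective G x
  have h2 : ∀ g ∈ G, ratRep g (2 • v.1) - 2 • v.1 ∈ integral := by
    intro g hg
    obtain ⟨n, m, h⟩ := exists_of_mem_lattice (v.2 g hg)
    refine mem_integral.2 ⟨fun i => 2 * n i + m, fun i => ?_⟩
    rw [map_nsmul, ← nsmul_sub, Pi.smul_apply, h, nsmul_eq_mul]
    push_cast
    ring
  obtain ⟨r, hr, h⟩ := exists_rounding h2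
  obtain ⟨a, ha⟩ := mem_integral.1 hr
  have hfix : ∀ g ∈ G, ratRep g (v.1 - fun i => (a i : ℚ) / 4) = v.1 - fun i => (a i : ℚ) / 4 := by
    have hr' : 2 • (v.1 - fun i => (a i : ℚ) / 4) = 2 • v.1 - r := by
      ext i
      have := ha i
      simp only [two_nsmul, Pi.add_apply, Pi.sub_apply] at this ⊢
      linarith
    intro g hg
    have := h g hg
    rw [← hr', map_nsmul] at this
    exact nsmul_right_injective two_ne_zero this
  have hmem : (fun i => (a i : ℚ) / 4) ∈ potentials G := by
    intro g hg
    have := hfix g hg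
    rw [map_sub, sub_eq_sub_iff_sub_eq_sub] at this
    rw [← this]
    exact v.2 g hg
  refine ⟨⟨_, hmem⟩, a, ?_, fun i => rfl⟩
  rw [eq_comm, ← sub_eq_zero, ← map_sub, classOf_eq_zero_iff]
  exact ⟨0, lattice.zero_mem, fun g hg => by rw [sub_zero]; exact hfix g hg⟩

/-! ### Half-integral displacements -/

theorem exists_signed_coord_eq {g : W} {v : Fin 5 → ℚ} {a : Fin 5 → ℤ} (ha : ∀ i, v i = a i / 4)
    (hg : ∃ n : Fin 5 → ℤ, ∀ i, (ratRep g v - v) i = n i + 1 / 2) :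
    ∃ k : Fin 5 → ℤ, ∀ i, (g.left.1 i : ℤ) * a (g.right⁻¹ i) = a i + 2 + 4 * k i := by
  obtain ⟨k, hk⟩ := hg
  refine ⟨k, fun i => ?_⟩
  have h := hk i
  rw [Pi.sub_apply, ratRep_apply, ha, ha] at h
  have h' : (((g.left.1 i : ℤ) * a (g.right⁻¹ i) : ℤ) : ℚ) = ((a i + 2 + 4 * k i : ℤ) : ℚ) := by
    push_cast
    linarith
  exact Int.cast_injective h'

/-- Comparing the squared lengths of `v = a/4` and `g v`: with `4 g v = a + 2 + 4 k`, the equality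
`∑ (a i + 2 + 4 k i)² = ∑ (a i)²` modulo `8` reads `4 ∑ a i + 20 ≡ 0`. -/
theorem odd_sum_of_half {g : W} {v : Fin 5 → ℚ} {a : Fin 5 → ℤ} (ha : ∀ i, v i = a i / 4)
    (hg : ∃ n : Fin 5 → ℤ, ∀ i, (ratRep g v - v) i = n i + 1 / 2) : Odd (∑ i, a i) := by
  obtain ⟨k, h1⟩ := exists_signed_coord_eq ha hg
  have h2 : ∀ i, a (g.right⁻¹ i) ^ 2 =
      a i ^ 2 + 4 * a i + 4 + 8 * (a i * k i + 2 * k i + 2 * k i ^ 2) := by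
    intro i
    have hs : ((g.left.1 i : ℤ)) ^ 2 = 1 := by
      rcases Int.units_eq_one_or (g.left.1 i) with hs | hs <;> simp [hs]
    have := congrArg (· ^ 2) (h1 i)
    simp only [mul_pow, hs, one_mul] at this
    rw [this]
    ring
  have h3 : ∑ i, a (g.right⁻¹ i) ^ 2 = ∑ i, a i ^ 2 := Equiv.sum_comp g.right⁻¹ fun i => a i ^ 2
  simp only [h2, Finset.sum_add_distrib, ← Finset.mul_sum, Finset.sum_const, Finset.card_univ,
    Fintype.card_fin, nsmul_eq_mul, Nat.cast_ofNat] at h3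
  rw [Int.odd_iff]
  omega

/-- Comparing the products of the coordinates: if all the `a i` are odd, then
`4 g v = a + 2 + 4 k ≡ -a` modulo `4`, so the odd numbers `∏ a i` and `∏ (4 g v) i` are opposite
modulo `4`. But they are equal, since the signs of `g` multiply to `1`. -/
theorem exists_even_of_half {g : W} {v : Fin 5 → ℚ} {a : Fin 5 → ℤ} (ha : ∀ i, v i = a i / 4)
    (hg : ∃ n : Fin 5 → ℤ, ∀ i, (ratRep g v - v) i = n i + 1 / 2) : ∃ i, Even (a i) := by
  by_contra! hodd
  simp only [Int.not_even_iff_odd] at hodd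
  obtain ⟨k, hk⟩ := exists_signed_coord_eq ha hg
  have h1 : ∀ i, (g.left.1 i : ℤ) * a (g.right⁻¹ i) ≡ -1 * a i [ZMOD 4] := by
    intro i
    obtain ⟨m, hm⟩ := hodd i
    rw [hk, Int.ModEq]
    omega
  have h2 : ∏ i, ((g.left.1 i : ℤ) * a (g.right⁻¹ i)) ≡ ∏ i, (-1 * a i) [ZMOD 4] :=
    Int.ModEq.prod fun i _ => h1 i
  have hs : ∏ i, (g.left.1 i : ℤ) = 1 := by
    have : ∏ i, g.left.1 i = 1 := g.left.2
    rw [← Units.coe_prod, this, Units.val_one]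
  rw [Finset.prod_mul_distrib, Finset.prod_mul_distrib, hs, Equiv.prod_comp g.right⁻¹ a,
    Finset.prod_const] at h2
  have hP : Odd (∏ i, a i) := Finset.prod_induction a Odd (fun _ _ => Odd.mul) odd_one
    fun i _ => hodd i
  obtain ⟨m, hm⟩ := hP
  rw [hm, Int.ModEq] at h2
  norm_num at h2
  omega

/-- An element of `G` moving `v` by a half-integral vector detects that twice the class of `v` does
not vanish. -/
theorem two_nsmul_classOf_ne_zero {G : Subgroup W} (v : potentials G) {a : Fin 5 → ℤ}
    (ha : ∀ i, v.1 i = a i / 4) {g : W} (hg : g ∈ G) (h : ratRep g v.1 - v.1 ∉ integral) :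
    2 • classOf G v ≠ 0 := by
  rw [← map_nsmul, Ne, classOf_eq_zero_iff]
  rintro ⟨p, hp, hfix⟩
  replace hfix : ratRep g (2 • v.1 - p) = 2 • v.1 - p := hfix g hg
  obtain ⟨k, hk⟩ := exists_half_of_mem_lattice (v.2 g hg) h
  obtain ⟨n, m, hn⟩ := exists_of_mem_lattice hp
  -- `g` fixes `2 v - p`, so it displaces `v' = 2 v - p / 2` by the same half-integral vector as
  -- `v`. All the coordinates of `4 v' = 8 v - 2 p` have the parity of `m`: if they are odd,
  -- this contradicts `exists_even_of_half`, and if they are even, `odd_sum_of_half`.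
  let v' : Fin 5 → ℚ := fun i => ((2 * a i - 2 * n i - m : ℤ) : ℚ) / 4
  have hv' : ∃ n : Fin 5 → ℤ, ∀ i, (ratRep g v' - v') i = n i + 1 / 2 := by
    refine ⟨k, fun i => ?_⟩
    rw [← hk i]
    have := congrFun hfix i
    simp only [two_nsmul, Pi.sub_apply, Pi.add_apply, ratRep_apply, v', ha, hn] at this ⊢
    push_cast at this ⊢
    linarith
  have hsum := odd_sum_of_half (a := fun i => 2 * a i - 2 * n i - m) (fun i => rfl) hv'
  obtain ⟨i, hi⟩ := exists_even_of_half (a := fun i => 2 * a i - 2 * n i - m) (fun i => rfl) hv'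
  have hm : Even m := by
    rw [Int.even_iff] at hi ⊢
    omega
  refine (Int.not_even_iff_odd.2 hsum) (Finset.even_sum _ fun i _ => ?_)
  rw [Int.even_iff] at hm ⊢
  omega

/-- An element displacing `v'` by a half-integral vector displaces `v` by one too, provided that
some `g₀` does so with `v`. Otherwise `g` would displace both `v'` and `v + v'` by half-integral
vectors, so that by `odd_sum_of_half` the coordinate sum of `4 v` would be even because of `g`, and
odd because of `g₀`. -/
theorem notMem_integral_of_notMem_integral {G G' : Subgroup W} {v : potentials G}
    {v' : potentials G'} {a a' : Fin 5 → ℤ}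
    (ha : ∀ i, v.1 i = a i / 4) (ha' : ∀ i, v'.1 i = a' i / 4)
    (hv : ∃ g ∈ G, ratRep g v.1 - v.1 ∉ integral) {g : W} (hg : g ∈ G')
    (h : ratRep g v'.1 - v'.1 ∉ integral) : ratRep g v.1 - v.1 ∉ integral := by
  intro hint
  obtain ⟨g₀, hg₀, h₀⟩ := hv
  have h1 := odd_sum_of_half ha (exists_half_of_mem_lattice (v.2 g₀ hg₀) h₀)
  obtain ⟨k, hk⟩ := exists_half_of_mem_lattice (v'.2 g hg) h
  obtain ⟨n, hn⟩ := mem_integral.1 hint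
  have h2 := odd_sum_of_half ha' ⟨k, hk⟩
  have h3 : Odd (∑ i, (a i + a' i)) := by
    refine odd_sum_of_half (g := g) (v := v.1 + v'.1) (fun i => ?_) ⟨n + k, fun i => ?_⟩
    · rw [Pi.add_apply, ha, ha']
      push_cast
      ring
    · rw [map_add, add_sub_add_comm, Pi.add_apply, hn, hk]
      push_cast [Pi.add_apply]
      ring
  rw [Finset.sum_add_distrib] at h3
  rw [Int.odd_iff] at h1 h2 h3
  omega

/-! ### The quotient by the `2`-torsion -/

theorem mem_H1Two {G : Subgroup W} {x : H1 G} : x ∈ H1Two G ↔ 2 • x = 0 := by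
  change (2 : ℤ) • x = 0 ↔ _
  rw [ofNat_zsmul]

theorem exists_notMem_integral {G : Subgroup W} {v : potentials G} (h : classOf G v ∉ H1Two G) :
    ∃ g ∈ G, ratRep g v.1 - v.1 ∉ integral := by
  by_contra! hv
  exact h (mem_H1Two.2 (two_nsmul_classOf_eq_zero v hv))

/-- If `x'` is any class on `G'` outside the `2`-torsion, an element of `G'` at which the character
of `x'` is nontrivial also witnesses that `res x` is outside the `2`-torsion. -/
theorem res_notMem_H1Two {G G' : Subgroup W} (hG : G' ≤ G) {x : H1 G} {x' : H1 G'}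
    (hx : x ∉ H1Two G) (hx' : x' ∉ H1Two G') : res hG x ∉ H1Two G' := by
  obtain ⟨v, a, rfl, ha⟩ := exists_classOf_eq x
  obtain ⟨v', a', rfl, ha'⟩ := exists_classOf_eq x'
  obtain ⟨g, hg, h⟩ := exists_notMem_integral hx'
  rw [res_classOf, mem_H1Two]
  exact two_nsmul_classOf_ne_zero ⟨v.1, _⟩ ha hg
    (notMem_integral_of_notMem_integral ha ha' (exists_notMem_integral hx) hg h)

/-- The classes outside the `2`-torsion all have the same character, so their differences come from
`H¹(G, ℤ⁵)`. -/
theorem sub_mem_H1Two {G : Subgroup W} {x y : H1 G} (hx : x ∉ H1Two G) (hy : y ∉ H1Two G) :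
    x - y ∈ H1Two G := by
  obtain ⟨u, a, rfl, ha⟩ := exists_classOf_eq x
  obtain ⟨v, b, rfl, hb⟩ := exists_classOf_eq y
  rw [mem_H1Two, ← map_sub]
  refine two_nsmul_classOf_eq_zero _ fun g hg => ?_
  change ratRep g (u.1 - v.1) - (u.1 - v.1) ∈ integral
  rw [map_sub, sub_sub_sub_comm]
  by_cases h : ratRep g u.1 - u.1 ∈ integral
  · refine integral.sub_mem h (by_contra fun h' => ?_)
    exact notMem_integral_of_notMem_integral ha hb (exists_notMem_integral hx) hg h' h
  · exact sub_mem_integral_of_notMem (u.2 g hg) (v.2 g hg) h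
      (notMem_integral_of_notMem_integral hb ha (exists_notMem_integral hy) hg h)

theorem card_quotient_H1Two {G : Subgroup W} {x : H1 G} (hx : x ∉ H1Two G) :
    Nat.card (H1 G ⧸ H1Two G) = 2 := by
  refine AddSubgroup.index_eq_two_iff_exists_notMem_and.2 ⟨-x, by simpa using hx, fun y => ?_⟩
  rw [or_iff_not_imp_right, ← sub_eq_add_neg]
  exact fun hy => sub_mem_H1Two hy hx

end OpenDelPezzo4

theorem mainTheorem8 (G G' : Subgroup OpenDelPezzo4.W) (hG : G' ≤ G)
    (h : ∃ x : OpenDelPezzo4.H1 G, OpenDelPezzo4.IsProperFourTorsion x)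
    (h' : ∃ x : OpenDelPezzo4.H1 G', OpenDelPezzo4.IsProperFourTorsion x) :
    Function.Bijective (OpenDelPezzo4.resBar hG) ∧
      Nat.card (OpenDelPezzo4.H1 G ⧸ OpenDelPezzo4.H1Two G) = 2 ∧
      Nat.card (OpenDelPezzo4.H1 G' ⧸ OpenDelPezzo4.H1Two G') = 2 := by
  obtain ⟨x, -, hx⟩ := h
  obtain ⟨x', -, hx'⟩ := h'
  rw [Ne, ← OpenDelPezzo4.mem_H1Two] at hx hx'
  have hcard := OpenDelPezzo4.card_quotient_H1Two hx
  have hcard' := OpenDelPezzo4.card_quotient_H1Two hx'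
  refine ⟨?_, hcard, hcard'⟩
  have : Finite (OpenDelPezzo4.H1 G ⧸ OpenDelPezzo4.H1Two G) :=
    Nat.finite_of_card_ne_zero (by omega)
  have : Finite (OpenDelPezzo4.H1 G' ⧸ OpenDelPezzo4.H1Two G') :=
    Nat.finite_of_card_ne_zero (by omega)
  refine (Nat.bijective_iff_injective_and_card _).2 ⟨?_, hcard.trans hcard'.symm⟩
  rw [injective_iff_map_eq_zero]
  intro y hy
  induction y using QuotientAddGroup.induction_on with | H y =>
  rw [QuotientAddGroup.eq_zero_iff]
  by_contra hy'
  exact OpenDelPezzo4.res_notMem_H1Two hG hy' hx' ((QuotientAddGroup.eq_zero_iff _).1 hy)
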